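/- Let $\mathcal H,\mathcal K$ be complex Hilbert spaces, let $m,M>0$ be real numbers, and let $A,B$ be bounded self-adjoint operators on $\mathcal H$ with $mI\le A\le MI$ and $mI\le B\le MI$ (operator order). Let $\Phi:\mathbb B(\mathcal H)\to\mathbb B(\mathcal K)$ be a positive unital linear map, $\nu\in[0,1]$, $r=\min\{\nu,1-\nu\}$ and $p>0$. For positive invertible operators $X,Y$ put $X\nabla_\nu Y=(1-\nu)X+\nu Y$ and $X\sharp_\nu Y=X^{1/2}\left(X^{-1/2}YX^{-1/2}\right)^\nu X^{1/2}$, and write $\nabla,\sharp$ for $\nabla_{1/2},\sharp_{1/2}$; real powers of positive operators are taken in the continuous functional calculus, and $\Phi^p(X)=(\Phi(X))^p$. Set $$\alpha=\max\left\{\frac{(M+m)^2}{4Mm},\ \frac{(M+m)^2}{4^{2/p}Mm}\right\}.$$ Then $$\Phi^p\left(A\nabla_\nu B+2rMm\left(A^{-1}\nabla B^{-1}-A^{-1}\sharp B^{-1}\right)\right)\le\alpha^p\,\Phi^p(A\sharp_\nu B)$$ and $$\Phi^p\left(A\nabla_\nu B+2rMm\left(A^{-1}\nabla B^{-1}-A^{-1}\sharp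 B^{-1}\right)\right)\le\alpha^p\left(\Phi(A)\sharp_\nu\Phi(B)\right)^p.$$ -/

import Mathlib

noncomputable section

/-- The weighted arithmetic mean `(1 - ν) A + ν B` of two bounded operators. -/
def arithMean {H : Type*} [NormedAddCommGroup H] [InnerProductSpace ℂ H]
    (ν : ℝ) (A B : H →L[ℂ] H) : H →L[ℂ] H :=
  (1 - ν) • A + ν • B

/-- The weighted geometric mean `A^(1/2) (A^(-1/2) B A^(-1/2))^ν A^(1/2)` of two positive
invertible operators; real powers are those of the continuous functional calculus. -/
def geomMean {H : Type*} [NormedAddCommGroup H] [InnerProductSpace ℂ H] [CompleteSpace H]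
    (ν : ℝ) (A B : H →L[ℂ] H) : H →L[ℂ] H :=
  A ^ (1 / 2 : ℝ) * (A ^ (-(1 / 2) : ℝ) * B * A ^ (-(1 / 2) : ℝ)) ^ ν * A ^ (1 / 2 : ℝ)

/-- The operator `A ∇_ν B + 2 r M m (A⁻¹ ∇ B⁻¹ - A⁻¹ ♯ B⁻¹)` with `r = min ν (1 - ν)`, where
`∇` and `♯` without an index are the means of weight `1 / 2`. -/
def refinedArithMean {H : Type*} [NormedAddCommGroup H] [InnerProductSpace ℂ H] [CompleteSpace H]
    (m M ν : ℝ) (A B : H →L[ℂ] H) : H →L[ℂ] H :=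
  arithMean ν A B + (2 * min ν (1 - ν) * M * m) •
    (arithMean (1 / 2) (Ring.inverse A) (Ring.inverse B)
      - geomMean (1 / 2) (Ring.inverse A) (Ring.inverse B))

end

open Set MeasureTheory
open scoped unitInterval NNReal

/-! Let G = A ♯_ν B and let x be the refined arithmetic mean. On [m, M] one has t + Mm t⁻¹ ≤ M + m,
because (t - m)(M - t) ≥ 0. Averaging this at A and B, and adding the refined Young inequality for
A⁻¹, B⁻¹ together with A⁻¹ ♯_ν B⁻¹ = G⁻¹, gives x + Mm G⁻¹ ≤ M + m. Applying Φ and Choi's inequality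
Φ(G)⁻¹ ≤ Φ(G⁻¹) yields S + k T⁻¹ ≤ c with S = Φ(x), T = Φ(G), k = Mm, c = M + m. By Ando's
inequality Φ(G) ≤ Φ(A) ♯_ν Φ(B), and inversion reverses order, so the same relation holds with T =
Φ(A) ♯_ν Φ(B).

This relation alone implies S^p ≤ α^p T^p. For q ≥ 1 it passes to S^q + k^q T^(-q) ≤ c^q; the
Bhatia–Kittaneh bound ‖XY‖ ≤ c²/4 for X, Y ≥ 0, X + Y ≤ c then controls ‖S^q T^(-q)‖, hence compares
S^(2q) with T^(2q). Taking q = max(1, p/2) and the Löwner–Heinz power p/(2q) ≤ 1 finishes; the two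
possible values of q give the two entries of the maximum in α. -/

/-! ### Simultaneous approximation of t and t⁻¹ -/

/-- The partition is the Bernstein basis transported to [m, M]. It replaces the spectral resolution
of a by finitely many continuous functions of a, which reduces Choi's inequality to a finite sum. -/
theorem Real.exists_partition_approx_id_inv {m M ε : ℝ} (hm : 0 < m) (hmM : m < M) (hε : 0 < ε) :
    ∃ (n : ℕ) (t : Fin n → ℝ) (h : Fin n → ℝ → ℝ), (∀ k, 0 < t k) ∧ (∀ k, Continuous (h k)) ∧
      (∀ k x, 0 ≤ h k x) ∧ (∀ x, ∑ k, h k x = 1) ∧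
      (∀ x ∈ Icc m M, ∑ k, t k * h k x ≤ x + ε) ∧
      (∀ x ∈ Icc m M, ∑ k, (t k)⁻¹ * h k x ≤ x⁻¹ + ε) := by
  have hpos (s : I) : 0 < m + (M - m) * s :=
    add_pos_of_pos_of_nonneg hm (mul_nonneg (by linarith) s.2.1)
  -- A plane curve, so that a single degree and a single set of nodes serve both t and t⁻¹.
  let f : C(I, ℝ × ℝ) :=
    ⟨fun s ↦ (m + (M - m) * s, (m + (M - m) * s)⁻¹),
      .prodMk (by fun_prop) (.inv₀ (by fun_prop) fun s ↦ (hpos s).ne')⟩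
  obtain ⟨n, hn⟩ := ((Metric.tendsto_nhds.1 (bernsteinApproximation_uniform f)) ε hε).exists
  let g : ℝ → I := fun x ↦ projIcc 0 1 zero_le_one ((x - m) / (M - m))
  have hg (x : ℝ) (hx : x ∈ Icc m M) : m + (M - m) * (g x : ℝ) = x := by
    have : (x - m) / (M - m) ∈ Icc (0 : ℝ) 1 :=
      ⟨div_nonneg (by linarith [hx.1]) (by linarith),
        (div_le_one (by linarith)).2 (by linarith [hx.2])⟩
    simp only [g, projIcc_of_mem zero_le_one this]
    have : M - m ≠ 0 := by linarith
    field_simp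
    ring
  have hclose (x : ℝ) : dist (bernsteinApproximation n f (g x)) (f (g x)) < ε :=
    (ContinuousMap.dist_lt_iff hε).1 hn (g x)
  refine ⟨n + 1, fun k ↦ (f (bernstein.z k)).1, fun k x ↦ bernstein n k (g x),
    fun k ↦ hpos _, fun k ↦ ?_, fun k x ↦ bernstein_nonneg,
    fun x ↦ bernstein.probability n (g x), fun x hx ↦ ?_, fun x hx ↦ ?_⟩
  · exact (bernstein n k).continuous.comp (continuous_projIcc.comp (by fun_prop))
  · have h := hclose x
    rw [Prod.dist_eq, max_lt_iff, Real.dist_eq, bernsteinApproximation.apply, Prod.fst_sum] at h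
    have h1 := (abs_lt.1 h.1).2
    have h2 : (f (g x)).1 = x := hg x hx
    simp only [Prod.smul_fst, smul_eq_mul, mul_comm (bernstein _ _ _)] at h1
    linarith
  · have h := hclose x
    rw [Prod.dist_eq, max_lt_iff, Real.dist_eq, Real.dist_eq, bernsteinApproximation.apply,
      Prod.snd_sum] at h
    have h1 := (abs_lt.1 h.2).2
    have h2 : (f (g x)).2 = x⁻¹ := congrArg (·⁻¹) (hg x hx)
    have h3 (k : Fin (n + 1)) : (f (bernstein.z k)).2 = ((f (bernstein.z k)).1)⁻¹ := rfl
    simp only [Prod.smul_snd, smul_eq_mul, mul_comm (bernstein _ _ _), h3] at h1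
    linarith

theorem PositiveLinearMap.map_algebraMap_of_map_one {A B : Type*} [CStarAlgebra A] [PartialOrder A]
    [CStarAlgebra B] [PartialOrder B] {Ψ : A →ₚ[ℂ] B} (hΨ : Ψ 1 = 1)
    (r : ℝ) :
    Ψ (algebraMap ℝ A r) = algebraMap ℝ B r := by
  rw [Algebra.algebraMap_eq_smul_one, Algebra.algebraMap_eq_smul_one,
    PositiveLinearMap.map_smul_of_tower, hΨ]

/-! ### Choi's inequality for the inverse -/

section Choi

variable {A B : Type*} [CStarAlgebra A] [PartialOrder A] [StarOrderedRing A]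
  [CStarAlgebra B] [PartialOrder B] [StarOrderedRing B]

theorem IsStrictlyPositive.exists_pos_spectrum_subset_Icc {a : A} (ha : IsStrictlyPositive a) :
    ∃ m M : ℝ, 0 < m ∧ m < M ∧ spectrum ℝ a ⊆ Icc m M := by
  have hK : IsCompact (spectrum ℝ a) := spectrum.isCompact a
  obtain ⟨m, hm, hml⟩ := hK.exists_forall_le' (f := id) continuousOn_id (a := 0)
    fun x hx ↦ ha.spectrum_pos hx
  obtain ⟨M, hM⟩ := hK.bddAbove
  exact ⟨m, max M (m + 1), hm, lt_max_of_lt_right (lt_add_one m),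
    fun x hx ↦ ⟨hml x hx, le_max_of_le_left (hM hx)⟩⟩

theorem IsStrictlyPositive.exists_pos_algebraMap_le {a : A} (ha : IsStrictlyPositive a) :
    ∃ m : ℝ, 0 < m ∧ algebraMap ℝ A m ≤ a := by
  obtain ⟨m, M, hm, -, h⟩ := ha.exists_pos_spectrum_subset_Icc
  exact ⟨m, hm, (algebraMap_le_iff_le_spectrum).2 fun x hx ↦ (h hx).1⟩

theorem PositiveLinearMap.isStrictlyPositive_map {Ψ : A →ₚ[ℂ] B} (hΨ : Ψ 1 = 1) {a : A}
    (ha : IsStrictlyPositive a) : IsStrictlyPositive (Ψ a) := by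
  obtain ⟨m, hm, h⟩ := ha.exists_pos_algebraMap_le
  refine (isStrictlyPositive_algebraMap (A := B) hm).of_le ?_
  rw [← map_algebraMap_of_map_one hΨ]
  exact OrderHomClass.mono Ψ h

/-- Each index contributes t⁻¹ (t d - 1) H (t d - 1) ≥ 0. Only positivity of the individual H is
used, so positivity of the map suffices, without 2-positivity. -/
theorem conjugate_sub_nonneg_of_partition {ι : Type*} [Fintype ι] {t : ι → ℝ} (ht : ∀ k, 0 < t k)
    {H : ι → B} (hH : ∀ k, 0 ≤ H k) {d : B} (hd : IsSelfAdjoint d) :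
    0 ≤ d * (∑ k, t k • H k) * d - d * (∑ k, H k) - (∑ k, H k) * d
      + ∑ k, (t k)⁻¹ • H k := by
  have key (k : ι) : 0 ≤ t k • (d * H k * d) - d * H k - H k * d + (t k)⁻¹ • H k := by
    have hs : IsSelfAdjoint (t k • d - 1) :=
      (IsSelfAdjoint.smul (IsSelfAdjoint.all (t k)) hd).sub (.one B)
    have h := smul_nonneg (inv_nonneg.2 (ht k).le) (hs.conjugate_nonneg (hH k))
    convert h using 1
    simp only [sub_mul, mul_sub, smul_mul_assoc, mul_smul_comm, smul_sub, smul_smul, one_mul,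
      mul_one, inv_mul_cancel₀ (ht k).ne', one_smul, inv_mul_cancel_left₀ (ht k).ne']
    abel
  have h := Finset.sum_nonneg fun k (_ : k ∈ Finset.univ) ↦ key k
  convert h using 1
  simp only [Finset.sum_add_distrib, Finset.sum_sub_distrib, Finset.mul_sum, Finset.sum_mul,
    mul_smul_comm, smul_mul_assoc]

/-- Choi's inequality for the inverse. -/
theorem PositiveLinearMap.ringInverse_map_le {Ψ : A →ₚ[ℂ] B} (hΨ : Ψ 1 = 1) {a : A}
    (ha : IsStrictlyPositive a) : Ring.inverse (Ψ a) ≤ Ψ (Ring.inverse a) := by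
  obtain ⟨m, M, hm, hmM, hspec⟩ := ha.exists_pos_spectrum_subset_Icc
  have hΨa := isStrictlyPositive_map hΨ ha
  set d := Ring.inverse (Ψ a) with hd
  have hdsa : IsSelfAdjoint d := hΨa.ringInverse.isSelfAdjoint
  have hdm : d * Ψ a = 1 := Ring.inverse_mul_cancel _ hΨa.isUnit
  -- The term ε d² is the error in approximating a, conjugated by d; the term ε is the error in
  -- approximating its inverse.
  have hε (ε : ℝ) (hε : 0 < ε) : 0 ≤ ε • (d * d + 1) + (Ψ (Ring.inverse a) - d) := by
    obtain ⟨n, t, h, ht, hc, h0, h1, hid, hinv⟩ :=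
      Real.exists_partition_approx_id_inv hm hmM hε
    have hcs (k : Fin n) : ContinuousOn (h k) (spectrum ℝ a) := (hc k).continuousOn
    let H : Fin n → B := fun k ↦ Ψ (cfc (h k) a)
    have hH (k : Fin n) : 0 ≤ H k := Ψ.map_nonneg (cfc_nonneg fun x _ ↦ h0 k x)
    have hsum (s : Fin n → ℝ) :
        ∑ k, s k • H k = Ψ (cfc (fun x ↦ ∑ k, s k * h k x) a) := by
      have heq : (fun x ↦ ∑ k, s k * h k x) = ∑ k, fun x ↦ s k * h k x := by
        ext x; simp
      rw [heq, cfc_sum_univ (fun k x ↦ s k * h k x) a (fun k ↦ (hcs k).const_mul _), map_sum]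
      refine Finset.sum_congr rfl fun k _ ↦ ?_
      rw [cfc_const_mul (s k) (h k) a (hcs k), PositiveLinearMap.map_smul_of_tower]
    have hcont (s : Fin n → ℝ) : ContinuousOn (fun x ↦ ∑ k, s k * h k x) (spectrum ℝ a) :=
      continuousOn_finsetSum _ fun k _ ↦ (hcs k).const_mul _
    have hone : ∑ k, H k = 1 := by
      have := hsum 1
      simp only [Pi.one_apply, one_smul, one_mul, h1] at this
      rw [this, cfc_const_one ℝ a, hΨ]
    have h2 : ∑ k, t k • H k ≤ Ψ a + ε • 1 := by
      rw [hsum, ← hΨ, ← PositiveLinearMap.map_smul_of_tower, ← map_add]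
      refine OrderHomClass.mono Ψ ?_
      calc _ ≤ cfc (fun x : ℝ ↦ x + ε) a :=
            cfc_mono (fun x hx ↦ hid x (hspec hx)) (hcont t)
        _ = a + ε • 1 := by
          rw [cfc_add_const ε (fun x ↦ x) a, cfc_id' ℝ a, Algebra.algebraMap_eq_smul_one]
    have hne : ∀ x ∈ spectrum ℝ a, x ≠ 0 := fun x hx ↦ (ha.spectrum_pos hx).ne'
    have h3 : ∑ k, (t k)⁻¹ • H k ≤ Ψ (Ring.inverse a) + ε • 1 := by
      rw [hsum, ← hΨ, ← PositiveLinearMap.map_smul_of_tower, ← map_add]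
      refine OrderHomClass.mono Ψ ?_
      have hic : ContinuousOn (fun x : ℝ ↦ x⁻¹) (spectrum ℝ a) :=
        continuousOn_id.inv₀ hne
      calc _ ≤ cfc (fun x : ℝ ↦ x⁻¹ + ε) a :=
            cfc_mono (fun x hx ↦ hinv x (hspec hx)) (hcont fun k ↦ (t k)⁻¹)
        _ = Ring.inverse a + ε • 1 := by
          rw [cfc_add_const ε (fun x ↦ x⁻¹) a hic, cfc_inv (fun x ↦ x) a hne, cfc_id' ℝ a,
            Algebra.algebraMap_eq_smul_one]
    have h4 := conjugate_sub_nonneg_of_partition ht hH hdsa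
    rw [hone, mul_one, one_mul] at h4
    have h5 := hdsa.conjugate_le_conjugate h2
    rw [mul_add, add_mul, hdm, one_mul, mul_smul_comm, mul_one, smul_mul_assoc] at h5
    calc (0 : B) ≤ d * (∑ k, t k • H k) * d - d - d + ∑ k, (t k)⁻¹ • H k := h4
      _ ≤ (d + ε • (d * d)) - d - d + (Ψ (Ring.inverse a) + ε • 1) := by gcongr
      _ = _ := by rw [smul_add]; abel
  rw [← sub_nonneg]
  have hlim : Filter.Tendsto (fun ε : ℝ ↦ ε • (d * d + 1) + (Ψ (Ring.inverse a) - d))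
      (nhdsWithin 0 (Ioi 0)) (nhds (Ψ (Ring.inverse a) - d)) := by
    have : Continuous fun ε : ℝ ↦ ε • (d * d + 1) + (Ψ (Ring.inverse a) - d) := by fun_prop
    simpa using (this.tendsto 0).mono_left nhdsWithin_le_nhds
  exact CStarAlgebra.isClosed_nonneg.mem_of_tendsto hlim
    (Filter.eventually_of_mem self_mem_nhdsWithin fun ε h ↦ hε ε h)

end Choi

/-! ### Jensen's operator inequality for powers in [0, 1] -/

section Jensen

variable {A B : Type*} [CStarAlgebra A] [PartialOrder A] [StarOrderedRing A]
  [CStarAlgebra B] [PartialOrder B] [StarOrderedRing B]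

/-- The integrand of the integral representation of a^p is a constant minus a positive multiple of a
resolvent, so Choi's inequality applies under the integral sign. -/
theorem cfcₙ_rpowIntegrand₀₁_eq_sub_ringInverse {p t : ℝ} (hp : p ∈ Ioo 0 1) (ht : 0 < t) {a : A}
    (ha : 0 ≤ a) : cfcₙ (Real.rpowIntegrand₀₁ p t) a =
      algebraMap ℝ A (t ^ (p - 1)) - t ^ p • Ring.inverse (algebraMap ℝ A t + a) := by
  have hspec : spectrum ℝ a ⊆ Ici 0 := fun x hx ↦ spectrum_nonneg_of_nonneg ha hx
  have hspectrum : ∀ r ∈ spectrum ℝ a, t + r ≠ 0 := fun r hr ↦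
    (add_pos_of_pos_of_nonneg ht (hspec hr)).ne'
  have hg : ContinuousOn (fun z : ℝ => (t + z)⁻¹) (spectrum ℝ a) :=
    ContinuousOn.inv₀ (by fun_prop) hspectrum
  rw [cfcₙ_eq_cfc (hf := (Real.continuousOn_rpowIntegrand₀₁_Ici hp ht).mono
      ((quasispectrum_eq_spectrum_union_zero ℝ a).le.trans
        (union_subset hspec (by simp))))
      (hf0 := Real.rpowIntegrand₀₁_zero_right),
    Real.rpowIntegrand₀₁_eq_sub hp.2.ne ht]
  have h1 := cfc_sub (fun _ : ℝ ↦ t ^ (p - 1)) (fun z : ℝ ↦ t ^ p * (t + z)⁻¹) a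
    continuousOn_const (hg.const_mul _)
  have h2 := cfc_const_mul (t ^ p) (fun z : ℝ ↦ (t + z)⁻¹) a hg
  have h3 := cfc_inv (fun z : ℝ ↦ t + z) a hspectrum (by fun_prop)
  have h4 := cfc_const_add t (fun z : ℝ ↦ z) a (by fun_prop)
  rw [h1, h2, h3, h4, cfc_const .., cfc_id' ..]

/-- Jensen's operator inequality for the concave powers. -/
theorem PositiveLinearMap.map_rpow_le {Ψ : A →ₚ[ℂ] B} (hΨ : Ψ 1 = 1) {a : A} (ha : 0 ≤ a)
    {p : ℝ} (hp : p ∈ Icc (0 : ℝ) 1) : Ψ (a ^ p) ≤ Ψ a ^ p := by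
  have hΨa : 0 ≤ Ψ a := Ψ.map_nonneg ha
  rcases hp.1.eq_or_lt with rfl | h0
  · rw [CFC.rpow_zero a ha, CFC.rpow_zero _ hΨa, hΨ]
  rcases hp.2.eq_or_lt with rfl | h1
  · rw [CFC.rpow_one a ha, CFC.rpow_one _ hΨa]
  lift p to ℝ≥0 using h0.le
  have hpI : p ∈ Ioo (0 : ℝ≥0) 1 := ⟨by exact_mod_cast h0, by exact_mod_cast h1⟩
  have hpR : (p : ℝ) ∈ Ioo (0 : ℝ) 1 := ⟨h0, h1⟩
  -- Working in the product algebra gives one measure that represents the powers of both a and Ψ a.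
  obtain ⟨μ, hμ⟩ := CFC.exists_measure_nnrpow_eq_integral_cfcₙ_rpowIntegrand₀₁ (A × B) hpI
  have hab : ((a, Ψ a) : A × B) ∈ Ici (0 : A × B) := ⟨ha, hΨa⟩
  obtain ⟨hint, heq⟩ := hμ _ hab
  have hprod : (a ^ p, Ψ a ^ p) =
      ∫ t in Ioi 0, cfcₙ (Real.rpowIntegrand₀₁ p t) ((a, Ψ a) : A × B) ∂μ :=
    (CFC.nnrpow_map_prod (a := a) (b := Ψ a) (x := p) ha hΨa).symm.trans heq
  have hcomp (t : ℝ) (ht : 0 < t) : cfcₙ (Real.rpowIntegrand₀₁ p t) ((a, Ψ a) : A × B) =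
      (cfcₙ (Real.rpowIntegrand₀₁ p t) a, cfcₙ (Real.rpowIntegrand₀₁ p t) (Ψ a)) := by
    refine cfcₙ_map_prod (S := ℝ) _ a (Ψ a) ?_ (IsSelfAdjoint.of_nonneg hab)
      (.of_nonneg ha) (.of_nonneg hΨa)
    exact (Real.continuousOn_rpowIntegrand₀₁_Ici hpR ht).mono (union_subset
      (fun x hx ↦ quasispectrum_nonneg_of_nonneg a ha x hx)
      (fun x hx ↦ quasispectrum_nonneg_of_nonneg (Ψ a) hΨa x hx))
  let L : A →L[ℝ] B :=
    ((Ψ.toLinearMap.restrictScalars ℝ : A →ₗ[ℝ] B)).mkContinuousOfExistsBound <| by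
      obtain ⟨C, hC⟩ := Ψ.exists_norm_apply_le
      exact ⟨C, hC⟩
  have hL (x : A) : L x = Ψ x := rfl
  have hint1 := hint.fst
  have hint2 := hint.snd
  have e1 : a ^ p = ∫ t in Ioi 0, (cfcₙ (Real.rpowIntegrand₀₁ p t) ((a, Ψ a) : A × B)).1 ∂μ := by
    rw [← fst_integral hint, ← hprod]
  have e2 : Ψ a ^ p =
      ∫ t in Ioi 0, (cfcₙ (Real.rpowIntegrand₀₁ p t) ((a, Ψ a) : A × B)).2 ∂μ := by
    rw [← snd_integral hint, ← hprod]
  rw [← CFC.nnrpow_eq_rpow hpI.1, ← CFC.nnrpow_eq_rpow hpI.1, e1, e2, ← hL,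
    ← L.integral_comp_comm hint1]
  refine integral_mono_ae (L.integrable_comp hint1) hint2 ?_
  filter_upwards [ae_restrict_mem measurableSet_Ioi] with t ht
  have ht : 0 < t := ht
  rw [hcomp t ht, hL, cfcₙ_rpowIntegrand₀₁_eq_sub_ringInverse hpR ht ha,
    cfcₙ_rpowIntegrand₀₁_eq_sub_ringInverse hpR ht hΨa, map_sub,
    PositiveLinearMap.map_algebraMap_of_map_one hΨ, PositiveLinearMap.map_smul_of_tower]
  have hsp : IsStrictlyPositive (algebraMap ℝ A t + a) :=
    (isStrictlyPositive_algebraMap ht).add_nonneg ha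
  have hchoi := PositiveLinearMap.ringInverse_map_le hΨ hsp
  rw [map_add, PositiveLinearMap.map_algebraMap_of_map_one hΨ] at hchoi
  exact sub_le_sub_left (smul_le_smul_of_nonneg_left hchoi (Real.rpow_nonneg ht.le _)) _

end Jensen

/-! ### The Bhatia–Kittaneh norm inequality -/

section BhatiaKittaneh

variable {K : Type*} [NormedAddCommGroup K] [InnerProductSpace ℂ K]

theorem ContinuousLinearMap.re_inner_nonneg_of_nonneg {X : K →L[ℂ] K} (hX : 0 ≤ X) (x : K) :
    0 ≤ (inner ℂ (X x) x).re :=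
  ((ContinuousLinearMap.nonneg_iff_isPositive X).1 hX).re_inner_nonneg_left x

theorem ContinuousLinearMap.inner_map_of_nonneg {X : K →L[ℂ] K} (hX : 0 ≤ X) (x y : K) :
    inner ℂ (X x) y = inner ℂ x (X y) :=
  ((ContinuousLinearMap.nonneg_iff_isPositive X).1 hX).isSymmetric x y

theorem ContinuousLinearMap.re_inner_le_of_le_smul_one {X : K →L[ℂ] K} {c : ℝ} (h : X ≤ c • 1)
    (x : K) : (inner ℂ (X x) x).re ≤ c * ‖x‖ ^ 2 := by
  have := ((ContinuousLinearMap.le_def _ _).1 h).re_inner_nonneg_left x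
  have e : inner ℂ ((c • (1 : K →L[ℂ] K) - X) x) x =
      ((c * ‖x‖ ^ 2 : ℝ) : ℂ) - inner ℂ (X x) x := by
    simp [inner_smul_left_eq_smul, inner_self_eq_norm_sq_to_K]
  rw [e, RCLike.re_to_complex, Complex.sub_re, Complex.ofReal_re] at this
  linarith

/-- This says that the row operator (X^(1/2), Y^(1/2)) has squared norm at most c. Square roots are
avoided by testing X at ca - z and Y at cb - z, where z = Xa + Yb, and adding. -/
theorem ContinuousLinearMap.sq_norm_add_le_of_add_le {X Y : K →L[ℂ] K} (hX : 0 ≤ X) (hY : 0 ≤ Y)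
    {c : ℝ} (hc : 0 < c) (h : X + Y ≤ c • 1) (a b : K) :
    ‖X a + Y b‖ ^ 2 ≤ c * ((inner ℂ (X a) a).re + (inner ℂ (Y b) b).re) := by
  set z := X a + Y b with hz
  have expand {T : K →L[ℂ] K} (hT : 0 ≤ T) (v : K) :
      (inner ℂ (T ((c : ℂ) • v - z)) ((c : ℂ) • v - z)).re =
        c ^ 2 * (inner ℂ (T v) v).re - 2 * c * (inner ℂ (T v) z).re + (inner ℂ (T z) z).re := by
    have e : (inner ℂ (T z) v).re = (inner ℂ (T v) z).re := by
      rw [inner_map_of_nonneg hT, ← inner_conj_symm, Complex.conj_re]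
    simp only [map_sub, map_smul, inner_sub_left, inner_sub_right, inner_smul_left,
      inner_smul_right, Complex.conj_ofReal, Complex.sub_re, Complex.re_ofReal_mul, e]
    ring
  have h1 := re_inner_nonneg_of_nonneg hX ((c : ℂ) • a - z)
  have h2 := re_inner_nonneg_of_nonneg hY ((c : ℂ) • b - z)
  rw [expand hX] at h1
  rw [expand hY] at h2
  have h3 := re_inner_le_of_le_smul_one h z
  have h4 : (inner ℂ (X a) z).re + (inner ℂ (Y b) z).re = ‖z‖ ^ 2 := by
    rw [← Complex.add_re, ← inner_add_left, ← hz]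
    exact inner_self_eq_norm_sq (𝕜 := ℂ) z
  rw [add_apply, inner_add_left, Complex.add_re] at h3
  have : 0 ≤ c * (c * ((inner ℂ (X a) a).re + (inner ℂ (Y b) b).re) - ‖z‖ ^ 2) := by
    linear_combination h1 + h2 + h3 - 2 * c * h4
  linarith [nonneg_of_mul_nonneg_right this hc]

variable [CompleteSpace K]

/-- Polarization of the form of X + Y at Xa ± Yb: the value at the difference is nonnegative, and
the value at the sum is at most c‖Xa + Yb‖². -/
theorem ContinuousLinearMap.four_mul_re_inner_le_of_add_le {X Y : K →L[ℂ] K} (hX : 0 ≤ X)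
    (hY : 0 ≤ Y) {c : ℝ} (hc : 0 < c) (h : X + Y ≤ c • 1) (a b : K) :
    4 * (inner ℂ ((X + Y) (Y b)) (X a)).re ≤
      c ^ 2 * ((inner ℂ (X a) a).re + (inner ℂ (Y b) b).re) := by
  have hR : 0 ≤ X + Y := add_nonneg hX hY
  have h1 := re_inner_nonneg_of_nonneg hR (X a - Y b)
  have h2 := re_inner_le_of_le_smul_one h (X a + Y b)
  have h3 := sq_norm_add_le_of_add_le hX hY hc h a b
  have e : (inner ℂ ((X + Y) (X a)) (Y b)).re = (inner ℂ ((X + Y) (Y b)) (X a)).re := by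
    rw [inner_map_of_nonneg hR, ← inner_conj_symm, Complex.conj_re]
  rw [map_sub, inner_sub_left, inner_sub_right, inner_sub_right, Complex.sub_re, Complex.sub_re,
    Complex.sub_re, e] at h1
  rw [map_add, inner_add_left, inner_add_right, inner_add_right, Complex.add_re, Complex.add_re,
    Complex.add_re, e] at h2
  have h4 := mul_le_mul_of_nonneg_left h3 hc.le
  linear_combination h1 + h2 + h4

/-- Let l = ‖XY‖. If w were an exact eigenvector of (XY)*(XY) = YX²Y for l², the vectors a = l Yw
and b = X²Yw would turn the preceding bound into 4 l q ≤ c² q with q > 0, so 4l ≤ c². The norm need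
not be attained, so w is only almost maximizing; the right side is the resulting error, which
vanishes as r tends to l. -/
theorem ContinuousLinearMap.approx_top_eigenvector_bound {X Y : K →L[ℂ] K} (hX : 0 ≤ X)
    (hY : 0 ≤ Y) {c : ℝ} (hc : 0 < c) (h : X + Y ≤ c • 1) (hl : c ^ 2 < 4 * ‖X * Y‖)
    {r : ℝ} (hr0 : 0 ≤ r) (hr : r < ‖X * Y‖) :
    (4 * ‖X * Y‖ - c ^ 2) * (‖X * Y‖ ^ 2 * r ^ 2) ≤
      c * (4 * (‖Y‖ * √(2 * ‖X * Y‖ ^ 4 - 2 * ‖X * Y‖ ^ 2 * r ^ 2) * ‖X * Y‖ ^ 2)) := by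
  obtain ⟨w, hw1, hw⟩ := (X * Y).exists_lt_apply_of_lt_opNorm hr
  set l := ‖X * Y‖ with hldef
  have hl0 : 0 ≤ l := norm_nonneg _
  set g := Y w with hg
  set p := X g with hp
  set b := X p with hb
  set W := Y b with hW
  have hpr : r < ‖p‖ := hw
  have hpl : ‖p‖ ≤ l := by
    simpa using (X * Y).le_opNorm_of_le hw1.le
  have hWp (x : K) : inner ℂ W x = inner ℂ p ((X * Y) x) := by
    rw [hW, hb, inner_map_of_nonneg hY, inner_map_of_nonneg hX]; rfl
  have hWl : ‖W‖ ≤ l ^ 2 := by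
    have h1 : ‖W‖ * ‖W‖ ≤ (l ^ 2) * ‖W‖ := by
      rw [← sq, ← @inner_self_eq_norm_sq ℂ, hWp]
      refine (Complex.re_le_norm _).trans ((norm_inner_le_norm _ _).trans ?_)
      have := (X * Y).le_opNorm W
      calc ‖p‖ * ‖(X * Y) W‖ ≤ l * (l * ‖W‖) := by gcongr
        _ = _ := by ring
    rcases (norm_nonneg W).eq_or_lt with h0 | h0
    · rw [← h0]; positivity
    · exact le_of_mul_le_mul_right h1 h0
  -- The defect of w as an eigenvector; its square norm is at most 2l⁴ - 2l²r².
  set v := W - ((l ^ 2 : ℝ) : ℂ) • w with hv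
  have hWw : (inner ℂ W w).re = ‖p‖ ^ 2 := by
    rw [hWp]; exact inner_self_eq_norm_sq (𝕜 := ℂ) p
  have hvn : ‖v‖ ^ 2 ≤ 2 * l ^ 4 - 2 * l ^ 2 * r ^ 2 := by
    have e : ‖v‖ ^ 2 = ‖W‖ ^ 2 - 2 * (l ^ 2 * (inner ℂ W w).re) + l ^ 4 * ‖w‖ ^ 2 := by
      rw [hv, @norm_sub_sq ℂ, inner_smul_right, norm_smul, Complex.norm_real,
        Real.norm_of_nonneg (sq_nonneg l)]
      simp only [RCLike.re_to_complex, Complex.re_ofReal_mul]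
      ring
    rw [e, hWw]
    have h1 : ‖W‖ ^ 2 ≤ (l ^ 2) ^ 2 := by gcongr
    have h2 : ‖w‖ ^ 2 ≤ 1 := pow_le_one₀ (norm_nonneg _) hw1.le
    have h3 : r ^ 2 ≤ ‖p‖ ^ 2 := by gcongr
    have h4 := mul_le_mul_of_nonneg_left h2 (pow_nonneg hl0 4)
    have h5 := mul_le_mul_of_nonneg_left h3 (sq_nonneg l)
    linarith
  have hvs : ‖v‖ ≤ √(2 * l ^ 4 - 2 * l ^ 2 * r ^ 2) := Real.le_sqrt_of_sq_le hvn
  set a := (l : ℂ) • g with ha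
  have hXa : X a = (l : ℂ) • p := by rw [ha, map_smul]
  have key := four_mul_re_inner_le_of_add_le hX hY hc h a b
  set q := (inner ℂ (X a) a).re + (inner ℂ (Y b) b).re with hq
  have hYW : Y W = (l : ℂ) • a + Y v := by
    rw [hv, map_sub, map_smul, ← hg, ha, smul_smul, sq, Complex.ofReal_mul]
    abel
  have e1 : (inner ℂ ((X + Y) (Y b)) (X a)).re = l * q + (inner ℂ (Y v) (X a)).re := by
    rw [add_apply, inner_add_left, Complex.add_re, inner_map_of_nonneg hX, ← hW, hYW,
      inner_add_left, Complex.add_re, hXa, map_smul, ← hb, ← hXa, inner_smul_right,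
      inner_smul_left, Complex.conj_ofReal, Complex.re_ofReal_mul, Complex.re_ofReal_mul,
      ← inner_map_of_nonneg hX a a, hq, hW]
    ring
  have e2 : -(‖Y‖ * √(2 * l ^ 4 - 2 * l ^ 2 * r ^ 2) * l ^ 2) ≤ (inner ℂ (Y v) (X a)).re := by
    have h1 : ‖inner ℂ (Y v) (X a)‖ ≤ ‖Y‖ * √(2 * l ^ 4 - 2 * l ^ 2 * r ^ 2) * l ^ 2 := by
      refine (norm_inner_le_norm _ _).trans ?_
      have h2 : ‖Y v‖ ≤ ‖Y‖ * √(2 * l ^ 4 - 2 * l ^ 2 * r ^ 2) :=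
        (Y.le_opNorm v).trans (by gcongr)
      have h3 : ‖X a‖ ≤ l ^ 2 := by
        rw [hXa, norm_smul, Complex.norm_real, Real.norm_of_nonneg hl0, sq]
        gcongr
      gcongr
    exact (neg_le_neg h1).trans (neg_le_of_abs_le (Complex.abs_re_le_norm _))
  rw [e1] at key
  -- A lower bound on q that stays positive as r tends to l, so that q can be eliminated.
  have hqr : l ^ 2 * r ^ 2 ≤ c * q := by
    have h1 := sq_norm_add_le_of_add_le hX hY hc h a 0
    rw [map_zero, add_zero, inner_zero_right, Complex.zero_re, add_zero, hXa, norm_smul,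
      Complex.norm_real, Real.norm_of_nonneg hl0, mul_pow, ← hXa] at h1
    have h2 := re_inner_nonneg_of_nonneg hY b
    have h3 : l ^ 2 * r ^ 2 ≤ l ^ 2 * ‖p‖ ^ 2 := by gcongr
    have h4 := mul_nonneg hc.le h2
    rw [hq, mul_add]
    linarith
  have h5 : (4 * l - c ^ 2) * q ≤ 4 * (‖Y‖ * √(2 * l ^ 4 - 2 * l ^ 2 * r ^ 2) * l ^ 2) := by
    linarith
  calc (4 * l - c ^ 2) * (l ^ 2 * r ^ 2) ≤ (4 * l - c ^ 2) * (c * q) := by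
        gcongr
    _ = c * ((4 * l - c ^ 2) * q) := by ring
    _ ≤ _ := by gcongr

/-- The arithmetic-geometric mean inequality of Bhatia and Kittaneh for the operator norm. -/
theorem ContinuousLinearMap.norm_mul_le_of_add_le {X Y : K →L[ℂ] K} (hX : 0 ≤ X) (hY : 0 ≤ Y)
    {c : ℝ} (hc : 0 < c) (h : X + Y ≤ c • 1) : ‖X * Y‖ ≤ c ^ 2 / 4 := by
  by_contra! hlt
  set l := ‖X * Y‖ with hl
  have hl0 : 0 < l := lt_of_le_of_lt (by positivity) hlt
  have hcl : c ^ 2 < 4 * l := by linarith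
  let F : ℝ → ℝ := fun r ↦ c * (4 * (‖Y‖ * √(2 * l ^ 4 - 2 * l ^ 2 * r ^ 2) * l ^ 2)) -
    (4 * l - c ^ 2) * (l ^ 2 * r ^ 2)
  have hF : Continuous F := by fun_prop
  have hlim : Filter.Tendsto F (nhdsWithin l (Iio l)) (nhds (F l)) :=
    (hF.tendsto l).mono_left nhdsWithin_le_nhds
  have hnonneg : 0 ≤ F l := by
    refine ge_of_tendsto hlim ?_
    filter_upwards [Ioo_mem_nhdsLT hl0] with r hr
    exact sub_nonneg.2 (approx_top_eigenvector_bound hX hY hc h hcl hr.1.le hr.2)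
  have : F l = -((4 * l - c ^ 2) * (l ^ 2 * l ^ 2)) := by
    have : 2 * l ^ 4 - 2 * l ^ 2 * l ^ 2 = 0 := by ring
    simp [F, this]
  have : 0 < (4 * l - c ^ 2) * (l ^ 2 * l ^ 2) := mul_pos (by linarith) (by positivity)
  linarith

end BhatiaKittaneh

/-! ### From S + k T⁻¹ ≤ c to a comparison of powers -/

section PowerOrder

variable {A : Type*} [CStarAlgebra A] [PartialOrder A] [StarOrderedRing A]

theorem CFC.smul_rpow {a : A} (ha : 0 ≤ a) {k q : ℝ} (hk : 0 ≤ k) (hq : 0 ≤ q) :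
    (k • a) ^ q = k ^ q • a ^ q := by
  have hc : ContinuousOn (fun x : ℝ ↦ x ^ q) (spectrum ℝ a) :=
    (Real.continuous_rpow_const hq).continuousOn
  rw [CFC.rpow_eq_cfc_real (smul_nonneg hk ha), CFC.rpow_eq_cfc_real ha,
    ← cfc_comp_smul k (fun x : ℝ ↦ x ^ q) a (Real.continuous_rpow_const hq).continuousOn,
    ← cfc_const_mul (k ^ q) (fun x : ℝ ↦ x ^ q) a hc]
  exact cfc_congr fun x hx ↦ Real.mul_rpow hk (spectrum_nonneg_of_nonneg ha hx)

theorem CFC.rpow_le_smul_of_le {a : A} (ha : 0 ≤ a) {c q : ℝ} (hq : 1 ≤ q)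
    (h : a ≤ algebraMap ℝ A c) : a ^ q ≤ c ^ (q - 1) • a := by
  have hspec := (le_algebraMap_iff_spectrum_le (a := a) (r := c)).1 h
  calc a ^ q = cfc (fun x : ℝ ↦ x ^ q) a := CFC.rpow_eq_cfc_real ha
    _ ≤ cfc (fun x : ℝ ↦ c ^ (q - 1) * x) a := by
      refine cfc_mono (fun x hx ↦ ?_)
        (Real.continuous_rpow_const (by linarith)).continuousOn (by fun_prop)
      have hx0 : 0 ≤ x := spectrum_nonneg_of_nonneg ha hx
      calc x ^ q = x ^ (q - 1) * x := by
            rw [← Real.rpow_add_one' hx0 (by linarith), sub_add_cancel]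
        _ ≤ c ^ (q - 1) * x := by
          gcongr
          exact hspec x hx
    _ = c ^ (q - 1) • a := by rw [cfc_const_mul _ _ a (by fun_prop), cfc_id' ℝ a]

/-- For q > 1 the power is not operator monotone; the chord bound x^q ≤ c^(q-1) x on [0, c] is
linear on the right, so it can be added for noncommuting a and b. -/
theorem CFC.rpow_add_rpow_le {a b : A} (ha : 0 ≤ a) (hb : 0 ≤ b) {c q : ℝ} (hc : 0 < c)
    (hq : 1 ≤ q) (h : a + b ≤ algebraMap ℝ A c) : a ^ q + b ^ q ≤ algebraMap ℝ A (c ^ q) := by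
  have h1 := rpow_le_smul_of_le ha hq ((le_add_of_nonneg_right hb).trans h)
  have h2 := rpow_le_smul_of_le hb hq ((le_add_of_nonneg_left ha).trans h)
  calc a ^ q + b ^ q ≤ c ^ (q - 1) • (a + b) := by rw [smul_add]; gcongr
    _ ≤ c ^ (q - 1) • algebraMap ℝ A c := by gcongr
    _ = algebraMap ℝ A (c ^ q) := by
      rw [Algebra.algebraMap_eq_smul_one, Algebra.algebraMap_eq_smul_one, smul_smul,
        ← Real.rpow_add_one hc.ne', sub_add_cancel]

/-- With d = b⁻¹, the norm bound reads (ad)*(ad) ≤ (C/r)²; conjugating by b gives the order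
relation. -/
theorem CStarAlgebra.mul_self_le_of_norm_mul_smul_le {a b d : A} (ha : IsSelfAdjoint a)
    (hb : IsSelfAdjoint b) (hd : IsSelfAdjoint d) (hbd : b * d = 1) {r C : ℝ}
    (hr : 0 < r) (h : ‖a * r • d‖ ≤ C) : a * a ≤ (C / r) ^ 2 • (b * b) := by
  have hdb : d * b = 1 := by simpa [hb.star_eq, hd.star_eq] using congrArg star hbd
  have hstar := (CStarAlgebra.star_mul_le_algebraMap_norm_sq (a := a * d)).trans
    (algebraMap_mono A (pow_le_pow_left₀ (norm_nonneg _) (b := C / r) (by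
      rwa [le_div_iff₀' hr, ← Real.norm_of_nonneg hr.le, ← norm_smul, ← mul_smul_comm]) 2))
  rw [star_mul, ha.star_eq, hd.star_eq] at hstar
  have hconj := hb.conjugate_le_conjugate hstar
  calc a * a = (b * d) * a * (a * (d * b)) := by rw [hbd, hdb, one_mul, mul_one]
    _ = b * (d * a * (a * d)) * b := by simp only [mul_assoc]
    _ ≤ b * algebraMap ℝ A ((C / r) ^ 2) * b := hconj
    _ = _ := by rw [Algebra.algebraMap_eq_smul_one, mul_smul_comm, mul_one, smul_mul_assoc]

theorem rpow_two_mul_le_of_add_smul_inverse_le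
    (hA : ∀ X Y : A, 0 ≤ X → 0 ≤ Y → ∀ c : ℝ, 0 < c → X + Y ≤ c • 1 → ‖X * Y‖ ≤ c ^ 2 / 4)
    {S T : A} (hS : IsStrictlyPositive S)
    (hT : IsStrictlyPositive T) {k c q : ℝ} (hk : 0 < k) (hc : 0 < c) (hq : 1 ≤ q)
    (h : S + k • Ring.inverse T ≤ c • 1) :
    S ^ (2 * q) ≤ (c ^ (4 * q) / (16 * k ^ (2 * q))) • T ^ (2 * q) := by
  have hq0 : q ≠ 0 := by linarith
  have hTi : 0 ≤ Ring.inverse T := hT.ringInverse.nonneg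
  have hadd := CFC.rpow_add_rpow_le hS.nonneg (smul_nonneg hk.le hTi) hc hq
    (by rwa [Algebra.algebraMap_eq_smul_one])
  rw [CFC.smul_rpow hTi hk.le (by linarith), Algebra.algebraMap_eq_smul_one,
    CFC.inverse_eq_rpow_neg_one hT, CFC.rpow_rpow T _ _ (by norm_num) hT, neg_one_mul] at hadd
  set N := T ^ (-q) with hN
  have hNs : IsSelfAdjoint N := CFC.rpow_nonneg.isSelfAdjoint
  have hkq : 0 < k ^ q := Real.rpow_pos_of_pos hk q
  have hnorm := hA _ _ CFC.rpow_nonneg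
    (smul_nonneg hkq.le CFC.rpow_nonneg) _ (Real.rpow_pos_of_pos hc q) hadd
  have hmul := CStarAlgebra.mul_self_le_of_norm_mul_smul_le
    (IsSelfAdjoint.of_nonneg CFC.rpow_nonneg) (IsSelfAdjoint.of_nonneg CFC.rpow_nonneg) hNs
    (CFC.rpow_mul_rpow_neg q hT) hkq hnorm
  rw [← CFC.rpow_add hS.isUnit, ← CFC.rpow_add hT.isUnit, ← two_mul] at hmul
  have e2 : c ^ (4 * q) = (c ^ q) ^ 4 := by
    rw [mul_comm, Real.rpow_mul hc.le]; norm_cast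
  have e3 : k ^ (2 * q) = (k ^ q) ^ 2 := by
    rw [mul_comm, Real.rpow_mul hk.le]; norm_cast
  have e4 : c ^ (4 * q) / (16 * k ^ (2 * q)) = ((c ^ q) ^ 2 / 4 / k ^ q) ^ 2 := by
    rw [e2, e3]
    field_simp
    norm_num
  rw [e4]
  exact hmul

theorem rpow_le_rpow_smul_of_add_smul_inverse_le
    (hA : ∀ X Y : A, 0 ≤ X → 0 ≤ Y → ∀ c : ℝ, 0 < c → X + Y ≤ c • 1 → ‖X * Y‖ ≤ c ^ 2 / 4)
    {S T : A} (hS : IsStrictlyPositive S)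
    (hT : IsStrictlyPositive T) {k c p : ℝ} (hk : 0 < k) (hc : 0 < c) (hp : 0 < p)
    (h : S + k • Ring.inverse T ≤ c • 1) :
    S ^ p ≤ (max (c ^ 2 / (4 * k)) (c ^ 2 / ((4 : ℝ) ^ (2 / p) * k))) ^ p • T ^ p := by
  -- The least q with q ≥ 1, as the chord bound requires, and p ≤ 2q, as Löwner–Heinz requires.
  set q : ℝ := max 1 (p / 2) with hqdef
  have hq : 1 ≤ q := le_max_left _ _
  have hq0 : 0 < q := by linarith
  have hpq : p ≤ 2 * q := by linarith [le_max_right 1 (p / 2)]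
  have hθ : p / (2 * q) ∈ Icc (0 : ℝ) 1 := ⟨by positivity, (div_le_one (by positivity)).2 hpq⟩
  have hpow := CFC.rpow_le_rpow hθ (rpow_two_mul_le_of_add_smul_inverse_le hA hS hT hk hc hq h)
  have hcancel : 2 * q * (p / (2 * q)) = p := by field_simp
  rw [CFC.smul_rpow CFC.rpow_nonneg (by positivity) hθ.1,
    CFC.rpow_rpow S _ _ (by positivity) hS, CFC.rpow_rpow T _ _ (by positivity) hT, hcancel] at hpow
  refine hpow.trans (smul_le_smul_of_nonneg_right ?_ CFC.rpow_nonneg)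
  have hβ : c ^ (4 * q) / (16 * k ^ (2 * q)) = (c ^ 2 / ((4 : ℝ) ^ (1 / q) * k)) ^ (2 * q) := by
    rw [Real.div_rpow (by positivity) (by positivity), Real.mul_rpow (by positivity) hk.le,
      ← Real.rpow_mul (by norm_num), ← Real.rpow_natCast c 2, ← Real.rpow_mul hc.le]
    have e1 : 1 / q * (2 * q) = (2 : ℕ) := by field_simp; norm_num
    rw [e1, Real.rpow_natCast]
    norm_num
    ring_nf
  rw [hβ, ← Real.rpow_mul (by positivity), hcancel]
  refine Real.rpow_le_rpow (by positivity) ?_ hp.le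
  rcases le_total 1 (p / 2) with h1 | h1
  · rw [hqdef, max_eq_right h1, one_div_div]
    exact le_max_right _ _
  · rw [hqdef, max_eq_left h1, div_one, Real.rpow_one]
    exact le_max_left _ _

end PowerOrder

/-! ### The refined scalar Young inequality -/

/-- After cancellation this is the weighted mean inequality between √x and the endpoint nearer in
exponent: 1 with weight 1 - 2ν if ν ≤ 1/2, and x with weight 2ν - 1 otherwise. -/
theorem Real.rpow_add_two_mul_min_mul_le {ν x : ℝ} (hν : ν ∈ Icc (0 : ℝ) 1) (hx : 0 < x) :
    x ^ ν + 2 * min ν (1 - ν) * (1 / 2 + 1 / 2 * x - x ^ (1 / 2 : ℝ)) ≤ (1 - ν) + ν * x := by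
  have hsq : x ^ (1 / 2 : ℝ) * x ^ (1 / 2 : ℝ) = x := by
    rw [← Real.rpow_add hx]; norm_num
  rcases le_total ν (1 - ν) with h | h
  · rw [min_eq_left h]
    have := Real.geom_mean_le_arith_mean2_weighted (w₁ := 1 - 2 * ν) (w₂ := 2 * ν) (p₁ := 1)
      (p₂ := x ^ (1 / 2 : ℝ)) (by linarith) (by linarith [hν.1]) zero_le_one (by positivity)
      (by ring)
    rw [Real.one_rpow, one_mul, ← Real.rpow_mul hx.le,
      show 1 / 2 * (2 * ν) = ν by ring] at this
    linarith
  · rw [min_eq_right h]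
    have := Real.geom_mean_le_arith_mean2_weighted (w₁ := 2 * ν - 1) (w₂ := 2 * (1 - ν)) (p₁ := x)
      (p₂ := x ^ (1 / 2 : ℝ)) (by linarith) (by linarith [hν.2]) hx.le (by positivity)
      (by ring)
    rw [← Real.rpow_mul hx.le, ← Real.rpow_add hx,
      show 2 * ν - 1 + 1 / 2 * (2 * (1 - ν)) = ν by ring] at this
    linarith

/-! ### Operator means and their behaviour under positive unital maps -/

section GeomMean

variable {A B : Type*} [CStarAlgebra A] [PartialOrder A] [StarOrderedRing A]
  [CStarAlgebra B] [PartialOrder B] [StarOrderedRing B]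

namespace CStarAlgebra

/-- The weighted geometric mean in a C⋆-algebra. -/
noncomputable def weightedGeomMean (ν : ℝ) (a b : A) : A :=
  a ^ (1 / 2 : ℝ) * (a ^ (-(1 / 2) : ℝ) * b * a ^ (-(1 / 2) : ℝ)) ^ ν * a ^ (1 / 2 : ℝ)

variable {a b : A}

theorem rpow_half_mul_rpow_half (ha : IsStrictlyPositive a) :
    a ^ (1 / 2 : ℝ) * a ^ (1 / 2 : ℝ) = a := by
  rw [← CFC.rpow_add ha.isUnit, add_halves, CFC.rpow_one a ha.nonneg]

theorem conj_rpow_half_conj_rpow_neg_half (ha : IsStrictlyPositive a) :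
    a ^ (1 / 2 : ℝ) * (a ^ (-(1 / 2) : ℝ) * b * a ^ (-(1 / 2) : ℝ)) * a ^ (1 / 2 : ℝ) = b := by
  have h1 := CFC.rpow_mul_rpow_neg (1 / 2) ha
  have h2 := CFC.rpow_neg_mul_rpow (1 / 2) ha
  calc _ = (a ^ (1 / 2 : ℝ) * a ^ (-(1 / 2) : ℝ)) * b * (a ^ (-(1 / 2) : ℝ) * a ^ (1 / 2 : ℝ)) := by
        simp only [mul_assoc]
    _ = b := by rw [h1, h2, one_mul, mul_one]

theorem isStrictlyPositive_conj_rpow (ha : IsStrictlyPositive a) (hb : IsStrictlyPositive b)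
    (s : ℝ) : IsStrictlyPositive (a ^ s * b * a ^ s) :=
  IsStrictlyPositive.conjugate_of_isUnit_of_isSelfAdjoint b (a ^ s) (ha.isUnit.cfcRpow s ha.nonneg)
    (.of_nonneg CFC.rpow_nonneg) hb

theorem isStrictlyPositive_weightedGeomMean (ha : IsStrictlyPositive a)
    (hb : IsStrictlyPositive b) (ν : ℝ) : IsStrictlyPositive (weightedGeomMean ν a b) :=
  isStrictlyPositive_conj_rpow ha ((isStrictlyPositive_conj_rpow ha hb _).rpow _ ν) _

theorem ringInverse_rpow (ha : IsStrictlyPositive a) (s : ℝ) :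
    Ring.inverse a ^ s = a ^ (-s) := by
  rw [CFC.inverse_eq_rpow_neg_one ha, CFC.rpow_rpow a _ _ (by norm_num) ha, neg_one_mul]

theorem weightedGeomMean_ringInverse (ha : IsStrictlyPositive a) (hb : IsStrictlyPositive b)
    (ν : ℝ) : weightedGeomMean ν (Ring.inverse a) (Ring.inverse b) =
      Ring.inverse (weightedGeomMean ν a b) := by
  have hc := isStrictlyPositive_conj_rpow ha hb (-(1 / 2))
  have hbb : b * Ring.inverse b = 1 := Ring.mul_inverse_cancel _ hb.isUnit
  set s := a ^ (1 / 2 : ℝ) with hs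
  set t := a ^ (-(1 / 2) : ℝ) with ht
  have hst : s * t = 1 := CFC.rpow_mul_rpow_neg (1 / 2) ha
  have hts : t * s = 1 := CFC.rpow_neg_mul_rpow (1 / 2) ha
  have hinv : s * Ring.inverse b * s = Ring.inverse (t * b * t) := by
    have h : (t * b * t) * (s * Ring.inverse b * s) = 1 := by
      calc _ = t * (b * ((t * s) * Ring.inverse b)) * s := by simp only [mul_assoc]
        _ = 1 := by rw [hts, one_mul, hbb, mul_one, hts]
    rw [← Ring.inverse_mul_cancel_left _ (s * Ring.inverse b * s) hc.isUnit, h, mul_one]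
  have hG := isStrictlyPositive_weightedGeomMean ha hb ν
  have hprod : weightedGeomMean ν a b *
      weightedGeomMean ν (Ring.inverse a) (Ring.inverse b) = 1 := by
    unfold weightedGeomMean
    rw [ringInverse_rpow ha, ringInverse_rpow ha, neg_neg, ← hs, ← ht, hinv, ringInverse_rpow hc]
    have h := CFC.rpow_mul_rpow_neg ν hc
    calc _ = s * ((t * b * t) ^ ν * (s * t) * (t * b * t) ^ (-ν)) * t := by simp only [mul_assoc]
      _ = 1 := by rw [hst, mul_one, h, mul_one, hst]
  rw [← Ring.inverse_mul_cancel_left _ (weightedGeomMean ν (Ring.inverse a) _) hG.isUnit, hprod,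
    mul_one]

/-- Scalar inequalities transfer to means: apply the functional calculus to a^(-1/2) b a^(-1/2) and
conjugate by a^(1/2). -/
theorem smul_weightedGeomMean_add_le {ν α β γ δ : ℝ} (ha : IsStrictlyPositive a)
    (hb : IsStrictlyPositive b)
    (h : ∀ x : ℝ, 0 < x → α * x ^ ν + β * x ^ (1 / 2 : ℝ) ≤ γ + δ * x) :
    α • weightedGeomMean ν a b + β • weightedGeomMean (1 / 2) a b ≤ γ • a + δ • b := by
  have hc := isStrictlyPositive_conj_rpow ha hb (-(1 / 2))
  have hsb : a ^ (1 / 2 : ℝ) * (a ^ (-(1 / 2) : ℝ) * b * a ^ (-(1 / 2) : ℝ)) * a ^ (1 / 2 : ℝ) =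
      b :=
    conj_rpow_half_conj_rpow_neg_half ha
  unfold weightedGeomMean
  set c := a ^ (-(1 / 2) : ℝ) * b * a ^ (-(1 / 2) : ℝ)
  have hcont (y : ℝ) : ContinuousOn (fun x : ℝ ↦ x ^ y) (spectrum ℝ c) :=
    continuousOn_id.rpow_const fun x hx ↦ .inl (hc.spectrum_pos hx).ne'
  have key : α • c ^ ν + β • c ^ (1 / 2 : ℝ) ≤ γ • 1 + δ • c := by
    calc α • c ^ ν + β • c ^ (1 / 2 : ℝ)
        = cfc (fun x : ℝ ↦ α * x ^ ν + β * x ^ (1 / 2 : ℝ)) c := by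
          rw [cfc_add c (fun x : ℝ ↦ α * x ^ ν) (fun x : ℝ ↦ β * x ^ (1 / 2 : ℝ))
            ((hcont _).const_mul _) ((hcont _).const_mul _),
            cfc_const_mul α (fun x : ℝ ↦ x ^ ν) c (hcont _),
            cfc_const_mul β (fun x : ℝ ↦ x ^ (1 / 2 : ℝ)) c (hcont _),
            CFC.rpow_eq_cfc_real hc.nonneg, CFC.rpow_eq_cfc_real hc.nonneg]
      _ ≤ cfc (fun x : ℝ ↦ γ + δ * x) c :=
          cfc_mono (fun x hx ↦ h x (hc.spectrum_pos hx))
            (((hcont _).const_mul _).add ((hcont _).const_mul _)) (by fun_prop)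
      _ = γ • 1 + δ • c := by
          rw [cfc_const_add γ (fun x ↦ δ * x) c (by fun_prop) hc.isSelfAdjoint,
            cfc_const_mul δ (fun x ↦ x) c (by fun_prop), cfc_id' ℝ c,
            Algebra.algebraMap_eq_smul_one]
  have hconj := (IsSelfAdjoint.of_nonneg
    (CFC.rpow_nonneg (a := a) (y := 1 / 2))).conjugate_le_conjugate key
  simpa only [mul_add, add_mul, mul_smul_comm, smul_mul_assoc, mul_one,
    rpow_half_mul_rpow_half ha, hsb] using hconj

theorem weightedGeomMean_half_le (ha : IsStrictlyPositive a) (hb : IsStrictlyPositive b) :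
    weightedGeomMean (1 / 2) a b ≤ (1 - 1 / 2 : ℝ) • a + (1 / 2 : ℝ) • b := by
  have := smul_weightedGeomMean_add_le (ν := 1 / 2) (α := 0) (β := 1) (γ := 1 - 1 / 2)
    (δ := 1 / 2) ha hb fun x hx ↦ by
      have h := Real.geom_mean_le_arith_mean2_weighted (w₁ := 1 / 2) (w₂ := 1 / 2) (p₁ := 1)
        (p₂ := x) (by norm_num) (by norm_num) zero_le_one hx.le (by norm_num)
      rw [Real.one_rpow, one_mul] at h
      linarith
  simpa only [zero_smul, one_smul, zero_add] using this

/-- The refined operator Young inequality of Kittaneh and Manasrah. -/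
theorem weightedGeomMean_add_le {ν : ℝ} (hν : ν ∈ Icc (0 : ℝ) 1) (ha : IsStrictlyPositive a)
    (hb : IsStrictlyPositive b) :
    weightedGeomMean ν a b + (2 * min ν (1 - ν)) •
        ((1 - 1 / 2 : ℝ) • a + (1 / 2 : ℝ) • b - weightedGeomMean (1 / 2) a b) ≤
      (1 - ν) • a + ν • b := by
  have := smul_weightedGeomMean_add_le (ν := ν) (α := 1) (β := -(2 * min ν (1 - ν)))
    (γ := (1 - ν) - 2 * min ν (1 - ν) * (1 / 2)) (δ := ν - 2 * min ν (1 - ν) * (1 / 2))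
    ha hb fun x hx ↦ by
      have h := Real.rpow_add_two_mul_min_mul_le hν hx
      linarith
  rw [← sub_nonneg] at this ⊢
  convert this using 1
  module

theorem add_smul_ringInverse_le {m M : ℝ} (hm : 0 < m) (hma : m • 1 ≤ a) (haM : a ≤ M • 1) :
    a + (M * m) • Ring.inverse a ≤ (M + m) • 1 := by
  rw [← Algebra.algebraMap_eq_smul_one] at hma haM
  have ha : IsStrictlyPositive a := (isStrictlyPositive_algebraMap hm).of_le hma
  have hl := (algebraMap_le_iff_le_spectrum (a := a)).1 hma
  have hu := (le_algebraMap_iff_spectrum_le (a := a)).1 haM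
  have hne : ∀ x ∈ spectrum ℝ a, x ≠ 0 := fun x hx ↦ (ha.spectrum_pos hx).ne'
  have hic : ContinuousOn (fun x : ℝ ↦ x⁻¹) (spectrum ℝ a) := continuousOn_id.inv₀ hne
  calc a + (M * m) • Ring.inverse a = cfc (fun x : ℝ ↦ x + M * m * x⁻¹) a := by
        rw [cfc_add a (fun x : ℝ ↦ x) (fun x ↦ M * m * x⁻¹) (by fun_prop) (hic.const_mul _),
          cfc_const_mul _ _ a hic, cfc_inv (fun x ↦ x) a hne, cfc_id' ℝ a]
    _ ≤ cfc (fun _ : ℝ ↦ M + m) a := by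
        refine cfc_mono (fun x hx ↦ ?_) (continuousOn_id.add (hic.const_mul _)) (by fun_prop)
        have hx0 := ha.spectrum_pos hx
        have h := mul_nonneg (sub_nonneg.2 (hl x hx)) (sub_nonneg.2 (hu x hx))
        rw [← sub_nonneg, show M + m - (x + M * m * x⁻¹) = (x - m) * (M - x) * x⁻¹ by
          field_simp; ring]
        positivity
    _ = (M + m) • 1 := by rw [cfc_const (M + m) a, Algebra.algebraMap_eq_smul_one]

theorem pos_of_smul_one_le_smul_one [Nontrivial A] {m M : ℝ} (hm : 0 < m)
    (h : m • (1 : A) ≤ M • 1) : 0 < M := by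
  by_contra! hM
  have h1 : m • (1 : A) ≤ 0 := h.trans (smul_nonpos_of_nonpos_of_nonneg hM zero_le_one)
  have h2 : m • (1 : A) = 0 := h1.antisymm (smul_nonneg hm.le zero_le_one)
  exact (smul_ne_zero hm.ne' one_ne_zero) h2

end CStarAlgebra

open CStarAlgebra

/-- The positive linear map `x ↦ t * x * t`. -/
noncomputable def PositiveLinearMap.conj (t : A) (ht : IsSelfAdjoint t) : A →ₚ[ℂ] A :=
  PositiveLinearMap.mk₀ ((LinearMap.mulLeft ℂ t).comp (LinearMap.mulRight ℂ t)) fun x hx ↦ by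
    simpa [mul_assoc] using ht.conjugate_nonneg hx

theorem PositiveLinearMap.conj_apply (t : A) (ht : IsSelfAdjoint t) (x : A) :
    PositiveLinearMap.conj t ht x = t * x * t :=
  (mul_assoc t x t).symm

/-- Ando's inequality for the geometric mean under a unital positive linear map. -/
theorem PositiveLinearMap.map_weightedGeomMean_le {Φ : A →ₚ[ℂ] B} (hΦ : Φ 1 = 1) {a b : A}
    (ha : IsStrictlyPositive a) (hb : IsStrictlyPositive b) {ν : ℝ} (hν : ν ∈ Icc (0 : ℝ) 1) :
    Φ (weightedGeomMean ν a b) ≤ weightedGeomMean ν (Φ a) (Φ b) := by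
  have hΦa := isStrictlyPositive_map hΦ ha
  have hs : IsSelfAdjoint (a ^ (1 / 2 : ℝ)) := .of_nonneg CFC.rpow_nonneg
  have ht : IsSelfAdjoint (Φ a ^ (-(1 / 2) : ℝ)) := .of_nonneg CFC.rpow_nonneg
  have hs' : IsSelfAdjoint (Φ a ^ (1 / 2 : ℝ)) := .of_nonneg CFC.rpow_nonneg
  -- Normalizing Φ by a^(1/2) inside and Φ(a)^(-1/2) outside makes it unital and sends a^(-1/2) b
  -- a^(-1/2) to Φ(a)^(-1/2) Φ(b) Φ(a)^(-1/2), so Jensen's inequality gives the claim after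
  -- conjugation.
  let Ψ : A →ₚ[ℂ] B := (PositiveLinearMap.conj _ ht).comp (Φ.comp (PositiveLinearMap.conj _ hs))
  have hΨ (x : A) : Ψ x = Φ a ^ (-(1 / 2) : ℝ) * Φ (a ^ (1 / 2 : ℝ) * x * a ^ (1 / 2 : ℝ)) *
      Φ a ^ (-(1 / 2) : ℝ) := by
    have h : Ψ x = PositiveLinearMap.conj _ ht (Φ (PositiveLinearMap.conj _ hs x)) := rfl
    rw [h, conj_apply, conj_apply]
  have hΨ1 : Ψ 1 = 1 := by
    rw [hΨ, mul_one, rpow_half_mul_rpow_half ha, CFC.conjugate_rpow_neg_one_half _ hΦa]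
  have hc := isStrictlyPositive_conj_rpow ha hb (-(1 / 2))
  have h := hs'.conjugate_le_conjugate (map_rpow_le hΨ1 hc.nonneg hν)
  rwa [hΨ, hΨ, conj_rpow_half_conj_rpow_neg_half hΦa, conj_rpow_half_conj_rpow_neg_half ha] at h

/-- The factor Mm in the refinement term matches the coefficient of the inverses, so Mm times
Young's inequality for a⁻¹, b⁻¹ absorbs it exactly. -/
theorem PositiveLinearMap.map_add_smul_ringInverse_le {Φ : A →ₚ[ℂ] B} (hΦ : Φ 1 = 1) {a b : A}
    {m M ν : ℝ} (hm : 0 < m) (hM : 0 < M) (hma : m • 1 ≤ a) (haM : a ≤ M • 1) (hmb : m • 1 ≤ b)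
    (hbM : b ≤ M • 1) (hν : ν ∈ Icc (0 : ℝ) 1) :
    Φ ((1 - ν) • a + ν • b + (2 * min ν (1 - ν) * M * m) •
        ((1 - 1 / 2 : ℝ) • Ring.inverse a + (1 / 2 : ℝ) • Ring.inverse b -
          weightedGeomMean (1 / 2) (Ring.inverse a) (Ring.inverse b))) +
      (M * m) • Ring.inverse (Φ (weightedGeomMean ν a b)) ≤ (M + m) • 1 := by
  have h1 : IsStrictlyPositive (m • (1 : A)) := .smul hm isStrictlyPositive_one
  have ha := h1.of_le hma
  have hb := h1.of_le hmb
  have hMm : 0 ≤ M * m := by positivity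
  have hchoi := ringInverse_map_le hΦ (isStrictlyPositive_weightedGeomMean ha hb ν)
  rw [← weightedGeomMean_ringInverse ha hb] at hchoi
  refine (add_le_add_right (smul_le_smul_of_nonneg_left hchoi hMm) _).trans ?_
  rw [← PositiveLinearMap.map_smul_of_tower, ← map_add, ← hΦ,
    ← PositiveLinearMap.map_smul_of_tower]
  refine OrderHomClass.mono Φ ?_
  have hY := smul_le_smul_of_nonneg_left
    (weightedGeomMean_add_le hν ha.ringInverse hb.ringInverse) hMm
  have hA := smul_le_smul_of_nonneg_left (add_smul_ringInverse_le hm hma haM) (sub_nonneg.2 hν.2)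
  have hB := smul_le_smul_of_nonneg_left (add_smul_ringInverse_le hm hmb hbM) hν.1
  have hsum := add_le_add (add_le_add hA hB) hY
  rw [← sub_nonneg] at hsum ⊢
  convert hsum using 1
  module

theorem CStarAlgebra.smul_one_le_add_smul_sub {a b : A} {m M ν : ℝ} (hm : 0 < m) (hM : 0 < M)
    (hma : m • 1 ≤ a) (hmb : m • 1 ≤ b) (hν : ν ∈ Icc (0 : ℝ) 1) :
    m • 1 ≤ (1 - ν) • a + ν • b + (2 * min ν (1 - ν) * M * m) •
        ((1 - 1 / 2 : ℝ) • Ring.inverse a + (1 / 2 : ℝ) • Ring.inverse b -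
          weightedGeomMean (1 / 2) (Ring.inverse a) (Ring.inverse b)) := by
  have h1 : IsStrictlyPositive (m • (1 : A)) := .smul hm isStrictlyPositive_one
  have hD := sub_nonneg.2
    (weightedGeomMean_half_le (h1.of_le hma).ringInverse (h1.of_le hmb).ringInverse)
  have hr : 0 ≤ 2 * min ν (1 - ν) * M * m := by
    have : 0 ≤ min ν (1 - ν) := le_min hν.1 (sub_nonneg.2 hν.2)
    positivity
  have hA := smul_le_smul_of_nonneg_left hma (sub_nonneg.2 hν.2)
  have hB := smul_le_smul_of_nonneg_left hmb hν.1
  have hsum := add_le_add hA hB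
  rw [← add_smul, sub_add_cancel, one_smul] at hsum
  exact hsum.trans (le_add_of_nonneg_right (smul_nonneg hr hD))

theorem PositiveLinearMap.map_rpow_le_smul_rpow_weightedGeomMean
    (hBK : ∀ X Y : B, 0 ≤ X → 0 ≤ Y → ∀ c : ℝ, 0 < c → X + Y ≤ c • 1 → ‖X * Y‖ ≤ c ^ 2 / 4)
    {Φ : A →ₚ[ℂ] B} (hΦ : Φ 1 = 1) {a b : A}
    {m M ν p : ℝ} (hm : 0 < m) (hM : 0 < M) (hma : m • 1 ≤ a) (haM : a ≤ M • 1) (hmb : m • 1 ≤ b)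
    (hbM : b ≤ M • 1) (hν : ν ∈ Icc (0 : ℝ) 1) (hp : 0 < p) {x : A}
    (hx : x = (1 - ν) • a + ν • b + (2 * min ν (1 - ν) * M * m) •
        ((1 - 1 / 2 : ℝ) • Ring.inverse a + (1 / 2 : ℝ) • Ring.inverse b -
          weightedGeomMean (1 / 2) (Ring.inverse a) (Ring.inverse b))) :
    Φ x ^ p ≤ (max ((M + m) ^ 2 / (4 * (M * m)))
        ((M + m) ^ 2 / ((4 : ℝ) ^ (2 / p) * (M * m)))) ^ p • Φ (weightedGeomMean ν a b) ^ p ∧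
    Φ x ^ p ≤ (max ((M + m) ^ 2 / (4 * (M * m)))
        ((M + m) ^ 2 / ((4 : ℝ) ^ (2 / p) * (M * m)))) ^ p •
          weightedGeomMean ν (Φ a) (Φ b) ^ p := by
  have h1 : IsStrictlyPositive (m • (1 : A)) := .smul hm isStrictlyPositive_one
  have ha := h1.of_le hma
  have hb := h1.of_le hmb
  have hx1 : m • 1 ≤ x := hx ▸ smul_one_le_add_smul_sub hm hM hma hmb hν
  have hS := isStrictlyPositive_map hΦ (h1.of_le hx1)
  have hT := isStrictlyPositive_map hΦ (isStrictlyPositive_weightedGeomMean ha hb ν)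
  have hle := map_weightedGeomMean_le hΦ ha hb hν
  have hsum := map_add_smul_ringInverse_le hΦ hm hM hma haM hmb hbM hν
  rw [← hx] at hsum
  have hMm : 0 < M * m := mul_pos hM hm
  refine ⟨rpow_le_rpow_smul_of_add_smul_inverse_le hBK hS hT hMm (by positivity) hp hsum,
    rpow_le_rpow_smul_of_add_smul_inverse_le hBK hS (hT.of_le hle) hMm (by positivity) hp ?_⟩
  -- Enlarging T to the mean of the images shrinks its inverse.
  refine le_trans ?_ hsum
  gcongr

end GeomMean

/-! ### The theorem for bounded operators -/

theorem theorem2p7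
    {H : Type*} [NormedAddCommGroup H] [InnerProductSpace ℂ H] [CompleteSpace H]
    {K : Type*} [NormedAddCommGroup K] [InnerProductSpace ℂ K] [CompleteSpace K]
    (m M : ℝ) (hm : 0 < m) (A B : H →L[ℂ] H)
    (hmA : m • (1 : H →L[ℂ] H) ≤ A) (hAM : A ≤ M • (1 : H →L[ℂ] H))
    (hmB : m • (1 : H →L[ℂ] H) ≤ B) (hBM : B ≤ M • (1 : H →L[ℂ] H))
    (Φ : (H →L[ℂ] H) →ₚ[ℂ] (K →L[ℂ] K)) (hΦ : Φ 1 = 1)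
    (ν : ℝ) (hν : ν ∈ Set.Icc (0 : ℝ) 1) (p : ℝ) (hp : 0 < p)
    (α : ℝ)
    (hα : α = max ((M + m) ^ 2 / (4 * M * m)) ((M + m) ^ 2 / ((4 : ℝ) ^ (2 / p) * M * m))) :
    Φ (refinedArithMean m M ν A B) ^ p ≤ α ^ p • Φ (geomMean ν A B) ^ p ∧
      Φ (refinedArithMean m M ν A B) ^ p ≤ α ^ p • geomMean ν (Φ A) (Φ B) ^ p := by
  -- Positivity of M follows from m ≤ M, which needs H nonzero; if H is zero, unitality of Φ forces
  -- 1 = 0 on K and both sides vanish.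
  cases subsingleton_or_nontrivial H with
  | inl hH =>
    have h0 : (1 : K →L[ℂ] K) = 0 := by
      rw [← hΦ, Subsingleton.elim (1 : H →L[ℂ] H) 0, map_zero]
    have hK : Subsingleton (K →L[ℂ] K) := subsingleton_of_zero_eq_one h0.symm
    exact ⟨(Subsingleton.elim _ _).le, (Subsingleton.elim _ _).le⟩
  | inr hH =>
    have hM := CStarAlgebra.pos_of_smul_one_le_smul_one hm (hmA.trans hAM)
    subst hα
    simp only [mul_assoc 4 M m, mul_assoc ((4 : ℝ) ^ (2 / p)) M m]
    have hBK (X Y : K →L[ℂ] K) (hX : 0 ≤ X) (hY : 0 ≤ Y) (c : ℝ) (hc : 0 < c)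
        (h : X + Y ≤ c • 1) : ‖X * Y‖ ≤ c ^ 2 / 4 :=
      ContinuousLinearMap.norm_mul_le_of_add_le hX hY hc h
    exact PositiveLinearMap.map_rpow_le_smul_rpow_weightedGeomMean hBK
      hΦ hm hM hmA hAM hmB hBM hν hp rfl
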